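/- Let $\mathcal H$ be a finite-dimensional complex Hilbert space. For positive definite operators $X,Y$ on $\mathcal H$ and $p\in[0,1]$ let \[ X\#_pY=Y^{1/2}\bigl(Y^{-1/2}XY^{-1/2}\bigr)^pY^{1/2} \] be the weighted geometric mean. A real-valued function $F$ on the set of positive definite operators on $\mathcal H$ is called strictly geodesically convex if \[ F(X\#_pY)<pF(X)+(1-p)F(Y) \] for all positive definite $X\ne Y$ and all $p\in(0,1)$. A function $f\colon(0,\infty)\to\mathbf R$ is called strictly convex-log if there is a strictly convex function $\Phi\colon\mathbf R\to\mathbf R$ such that $f(t)=\Phi(\log t)$ for all $t>0$. Let $A$ be a positive definite operator on $\mathcal H$, and let $f\colon(0,\infty)\to\mathbf R$ be a real analytic, strictly convex-log function. Then the trace function \[ F_A(X)=\operatorname{Tr} f\bigl(X^{-1/2}AX^{-1/2}\bigr), \] where $f(\cdot)$ is given by the functional calculus, is strictly geodesically convex in positive definite operators $X$ on $\mathcal H$. -/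

import Mathlib

noncomputable section

namespace GeodConvex

variable {H : Type*} [NormedAddCommGroup H] [InnerProductSpace ℂ H] [CompleteSpace H]

/-- The weighted geometric mean `X #_p Y = Y^{1/2} (Y^{-1/2} X Y^{-1/2})^p Y^{1/2}`;
operator powers are those of the continuous functional calculus. -/
def geomMean (p : ℝ) (X Y : H →L[ℂ] H) : H →L[ℂ] H :=
  Y ^ (1 / 2 : ℝ) * (Y ^ (-(1 / 2) : ℝ) * X * Y ^ (-(1 / 2) : ℝ)) ^ p * Y ^ (1 / 2 : ℝ)

/-- The function `F`, defined on the positive definite operators (its values elsewhere are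
irrelevant), is strictly geodesically convex. For `X = Y` and for `p = 0, 1` the two sides of
the inequality coincide. -/
def IsStrictlyGeodConvex (F : (H →L[ℂ] H) → ℝ) : Prop :=
  ∀ X Y : H →L[ℂ] H, IsStrictlyPositive X → IsStrictlyPositive Y → X ≠ Y →
    ∀ p : ℝ, 0 < p → p < 1 → F (geomMean p X Y) < p * F X + (1 - p) * F Y

/-- A function `f` on `(0, ∞)` is strictly convex-log if `f(t) = Φ(log t)` for a strictly convex
function `Φ` on the real line. -/
def IsStrictlyConvexLog (f : ℝ → ℝ) : Prop :=
  ∃ Φ : ℝ → ℝ, StrictConvexOn ℝ Set.univ Φ ∧ ∀ t : ℝ, 0 < t → f t = Φ (Real.log t)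

/-- `Tr f(Z)` for a self-adjoint operator `Z`, with `f(Z)` given by the functional calculus.
As `f(Z)` is self-adjoint, its trace is real, and taking the real part only changes the type. -/
def traceFun (f : ℝ → ℝ) (Z : H →L[ℂ] H) : ℝ :=
  (LinearMap.trace ℂ H (cfc f Z : H →L[ℂ] H).toLinearMap).re

/-- The trace function `F_A(X) = Tr f(X^{-1/2} A X^{-1/2})`. -/
def traceFunAt (f : ℝ → ℝ) (A X : H →L[ℂ] H) : ℝ :=
  traceFun f (X ^ (-(1 / 2) : ℝ) * A * X ^ (-(1 / 2) : ℝ))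

end GeodConvex

end

noncomputable section
namespace GeodConvex
open Finset Matrix Module
open scoped InnerProductSpace

/-! Put `C = Y^{-1/2} A^{1/2}` and `N = (Y^{-1/2} X Y^{-1/2})⁻¹`. Since `PP*` and `P*P` have the
same eigenvalues, and inversion carries the geodesic to `Y^{-1/2} N^p Y^{-1/2}`, the values of `F_A`
at `X #_p Y`, `X`, `Y` are the traces of `f` at `C*N^pC`, `C*NC`, `C*C`.

The eigenvalues of `C*N^pC` are log-majorized by the products `λ_i(C*NC)^p λ_i(C*C)^{1-p}`. Indeed a
`k × k` Gram determinant of `C*N^pC` is, by Cauchy–Binet, a sum of nonnegative weights times `p`-th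
powers, hence log-convex in `p` by Hölder, and its maximum over orthonormal frames is the product of
the `k` largest eigenvalues. For full `k`, multiplicativity of `det` gives equality. Karamata and
then Jensen for `Φ` give the inequality (`sum_lt_sum_of_majorized`, `traceFun_geodesic_lt`).

If neither is strict, the three spectra coincide; comparing ordinary traces then forces `N = 1`,
that is `X = Y` (`eq_one_of_eigs_geodesic_eq`). -/

/-! ### Cauchy–Binet and sums of minors -/

/-- Cauchy–Binet over all maps `f` instead of `k`-subsets: non-injective maps contribute zero and
each subset is counted `k!` times. Permuting `f` by `σ` in the multilinear expansion produces the
sign needed to assemble the minor of `A`. -/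
theorem factorial_mul_det_mul {n R : Type*} [Fintype n] [CommRing R] {k : ℕ}
    (A : Matrix (Fin k) n R) (B : Matrix n (Fin k) R) :
    (k.factorial : R) * (A * B).det =
      ∑ f : Fin k → n, (A.submatrix id f).det * (B.submatrix f id).det := by
  classical
  have expand : (A * B).det = ∑ f : Fin k → n, (∏ i, A i (f i)) * (B.submatrix f id).det := by
    have h1 : (A * B).det = detRowAlternating (fun i => ∑ l, A i l • B l) := by
      change (A * B).det = Matrix.det _
      congr 1
      ext i j
      simp [Matrix.mul_apply]
    rw [h1]
    have h2 := (detRowAlternating (R := R) (n := Fin k)).toMultilinearMap.map_sum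
      (fun i l => A i l • B l)
    refine h2.trans (Finset.sum_congr rfl fun f _ => ?_)
    exact (detRowAlternating (R := R) (n := Fin k)).toMultilinearMap.map_smul_univ _ _
  have key : ∀ σ : Equiv.Perm (Fin k),
      ∑ f : Fin k → n, (Equiv.Perm.sign σ : R) * (∏ i, A (σ i) (f i)) * (B.submatrix f id).det =
        (A * B).det := by
    intro σ
    rw [expand]
    refine Fintype.sum_equiv (σ.arrowCongr (Equiv.refl n)) _ _ fun f => ?_
    have hB : (B.submatrix (σ.arrowCongr (Equiv.refl n) f) id).det =
        (Equiv.Perm.sign σ : R) * (B.submatrix f id).det := by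
      rw [← Equiv.Perm.sign_symm, ← Matrix.det_permute σ.symm]
      rfl
    have hA : ∏ i, A i (σ.arrowCongr (Equiv.refl n) f i) = ∏ i, A (σ i) (f i) := by
      rw [← Equiv.prod_comp σ]
      simp [Equiv.arrowCongr]
    rw [hA, hB]
    ring
  calc (k.factorial : R) * (A * B).det = ∑ _σ : Equiv.Perm (Fin k), (A * B).det := by
        simp [Fintype.card_perm]
    _ = ∑ σ : Equiv.Perm (Fin k), ∑ f : Fin k → n,
          (Equiv.Perm.sign σ : R) * (∏ i, A (σ i) (f i)) * (B.submatrix f id).det :=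
        Finset.sum_congr rfl fun σ _ => (key σ).symm
    _ = _ := by
        rw [Finset.sum_comm]
        refine Finset.sum_congr rfl fun f _ => ?_
        rw [← Finset.sum_mul, Matrix.det_apply' (A.submatrix id f)]
        rfl

/-- `k!` times the determinant of the compression `Bᴴ * diagonal d * B`, as a sum of minors. -/
def minorSum {n : Type*} [Fintype n] {k : ℕ} (B : Matrix n (Fin k) ℂ) (d : n → ℝ) : ℝ :=
  ∑ f : Fin k → n, (∏ i, d (f i)) * Complex.normSq (B.submatrix f id).det

theorem factorial_mul_det_conj_diagonal {n : Type*} [Fintype n] [DecidableEq n] {k : ℕ}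
    (B : Matrix n (Fin k) ℂ) (d : n → ℝ) :
    (k.factorial : ℂ) * (Bᴴ * (diagonal (fun l => (d l : ℂ)) * B)).det = (minorSum B d : ℂ) := by
  rw [factorial_mul_det_mul, minorSum, Complex.ofReal_sum]
  refine Finset.sum_congr rfl fun f _ => ?_
  have h1 : (Bᴴ.submatrix id f).det = star (B.submatrix f id).det := by
    rw [← Matrix.det_conjTranspose]; rfl
  have h2 : ((diagonal (fun l => (d l : ℂ)) * B).submatrix f id).det =
      (∏ i, (d (f i) : ℂ)) * (B.submatrix f id).det := by
    rw [← Matrix.det_mul_column]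
    congr 1
    ext i j
    simp [Matrix.diagonal_mul]
  rw [h1, h2, Complex.ofReal_mul, Complex.normSq_eq_conj_mul_self]
  simp only [Complex.ofReal_prod, starRingEnd_apply]
  ring

theorem minorSum_nonneg {n : Type*} [Fintype n] {k : ℕ} (B : Matrix n (Fin k) ℂ) {d : n → ℝ}
    (hd : ∀ l, 0 ≤ d l) : 0 ≤ minorSum B d :=
  Finset.sum_nonneg fun _ _ =>
    mul_nonneg (Finset.prod_nonneg fun _ _ => hd _) (Complex.normSq_nonneg _)

/-- Hölder with exponents `1/p` and `1/(1-p)`, applied to `t^p c = (tc)^p c^{1-p}`. -/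
theorem sum_rpow_mul_le {ι : Type*} (s : Finset ι) (t c : ι → ℝ) (ht : ∀ i, 0 ≤ t i)
    (hc : ∀ i, 0 ≤ c i) {p : ℝ} (hp0 : 0 < p) (hp1 : p < 1) :
    ∑ i ∈ s, t i ^ p * c i ≤ (∑ i ∈ s, t i * c i) ^ p * (∑ i ∈ s, c i) ^ (1 - p) := by
  have hpq : (1 / p).HolderConjugate (1 / (1 - p)) := by
    rw [Real.holderConjugate_iff]
    refine ⟨by rw [lt_div_iff₀ hp0]; linarith, by simp⟩
  have h := Real.inner_le_Lp_mul_Lq_of_nonneg s hpq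
    (f := fun i => (t i * c i) ^ p) (g := fun i => c i ^ (1 - p))
    (fun i _ => Real.rpow_nonneg (mul_nonneg (ht i) (hc i)) _)
    (fun i _ => Real.rpow_nonneg (hc i) _)
  have hq : 1 - p ≠ 0 := by linarith
  have e1 : ∀ i, ((t i * c i) ^ p) ^ (1 / p) = t i * c i := fun i => by
    rw [one_div, Real.rpow_rpow_inv (mul_nonneg (ht i) (hc i)) hp0.ne']
  have e2 : ∀ i, (c i ^ (1 - p)) ^ (1 / (1 - p)) = c i := fun i => by
    rw [one_div, Real.rpow_rpow_inv (hc i) hq]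
  simp only [e1, e2, one_div_one_div] at h
  refine le_trans (le_of_eq (Finset.sum_congr rfl fun i _ => ?_)) h
  rw [Real.mul_rpow (ht i) (hc i), mul_assoc, ← Real.rpow_add' (hc i) (by simp)]
  simp

theorem minorSum_rpow_le {n : Type*} [Fintype n] {k : ℕ} (B : Matrix n (Fin k) ℂ) {d : n → ℝ}
    (hd : ∀ l, 0 ≤ d l) {p : ℝ} (hp0 : 0 < p) (hp1 : p < 1) :
    minorSum B (fun l => d l ^ p) ≤ minorSum B d ^ p * minorSum B (fun _ => 1) ^ (1 - p) := by
  have h := sum_rpow_mul_le (Finset.univ : Finset (Fin k → n)) (fun f => ∏ i, d (f i))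
    (fun f => Complex.normSq (B.submatrix f id).det)
    (fun f => Finset.prod_nonneg fun _ _ => hd _) (fun f => Complex.normSq_nonneg _) hp0 hp1
  simp only [minorSum, Finset.prod_const_one, one_mul]
  refine le_trans (le_of_eq (Finset.sum_congr rfl fun f _ => ?_)) h
  rw [Real.finsetProd_rpow _ _ fun i _ => hd _]

/-- In the increasing enumeration of the image of `f`, the `m`-th element is at least `m`. -/
theorem prod_comp_le_prod_castLE {n k : ℕ} (hk : k ≤ n) {d : Fin n → ℝ} (hd : ∀ l, 0 ≤ d l)
    (hanti : Antitone d) {f : Fin k → Fin n} (hf : Function.Injective f) :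
    ∏ i, d (f i) ≤ ∏ i : Fin k, d (Fin.castLE hk i) := by
  classical
  have hcard : (Finset.univ.image f).card = k := by
    rw [Finset.card_image_of_injective _ hf]; simp
  let e := (Finset.univ.image f).orderEmbOfFin hcard
  have hprod : ∏ i, d (f i) = ∏ i, d (e i) := by
    rw [← Finset.prod_image (f := d) (g := f) (fun a _ b _ h => hf h),
      ← Finset.prod_image (f := d) (g := e) (fun a _ b _ h => e.injective h)]
    congr 1
    exact (Finset.image_orderEmbOfFin_univ _ hcard).symm
  rw [hprod]
  refine Finset.prod_le_prod (fun i _ => hd _) fun i _ => hanti ?_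
  have : ∀ m (hm : m < k), m ≤ (e ⟨m, hm⟩ : ℕ) := by
    intro m
    induction m with
    | zero => intro _; exact Nat.zero_le _
    | succ m ih =>
      intro hm
      have h1 := ih (by omega)
      have h2 : e ⟨m, by omega⟩ < e ⟨m + 1, hm⟩ := e.strictMono (by simp [Fin.lt_def])
      have h3 : (e ⟨m, by omega⟩ : ℕ) < e ⟨m + 1, hm⟩ := h2
      omega
  exact this i i.2

theorem minorSum_le_prod_castLE {n k : ℕ} (hk : k ≤ n) (B : Matrix (Fin n) (Fin k) ℂ)
    {d : Fin n → ℝ} (hd : ∀ l, 0 ≤ d l) (hanti : Antitone d) :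
    minorSum B d ≤ (∏ i : Fin k, d (Fin.castLE hk i)) * minorSum B (fun _ => 1) := by
  rw [minorSum, minorSum, Finset.mul_sum]
  refine Finset.sum_le_sum fun f _ => ?_
  by_cases hf : Function.Injective f
  · simpa using mul_le_mul_of_nonneg_right (prod_comp_le_prod_castLE hk hd hanti hf)
      (Complex.normSq_nonneg _)
  · obtain ⟨i, j, hij, hne⟩ := Function.not_injective_iff.mp hf
    have : (B.submatrix f id).det = 0 := Matrix.det_zero_of_row_eq hne (by ext; simp [hij])
    simp [this]

/-! ### Majorization and Karamata's inequality -/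

/-- Abel summation: the boundary term vanishes by `hz0`, and what remains pairs the decrements of
`g` with partial sums of `z`. -/
theorem sum_mul_nonneg_of_antitone {n : ℕ} {g z : Fin n → ℝ} (hg : Antitone g)
    (hz : ∀ (k : ℕ) (hk : k ≤ n), 0 ≤ ∑ i : Fin k, z (Fin.castLE hk i)) (hz0 : ∑ i, z i = 0) :
    0 ≤ ∑ i, g i * z i := by
  let G : ℕ → ℝ := fun i => if h : i < n then g ⟨i, h⟩ else 0
  let Z : ℕ → ℝ := fun i => if h : i < n then z ⟨i, h⟩ else 0
  have hZ : ∀ (k : ℕ) (hk : k ≤ n),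
      ∑ i ∈ Finset.range k, Z i = ∑ i : Fin k, z (Fin.castLE hk i) := by
    intro k hk
    rw [← Fin.sum_univ_eq_sum_range]
    refine Finset.sum_congr rfl fun i _ => ?_
    have : (i : ℕ) < n := by omega
    simp only [Z, this, dite_true]
    rfl
  have h0 : ∑ i, g i * z i = ∑ i ∈ Finset.range n, G i • Z i := by
    rw [← Fin.sum_univ_eq_sum_range]
    simp [G, Z]
  have hZn : ∑ i ∈ Finset.range n, Z i = 0 := by
    rw [hZ n le_rfl, ← hz0]; rfl
  rw [h0, Finset.sum_range_by_parts, hZn, smul_zero, zero_sub, ← Finset.sum_neg_distrib]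
  refine Finset.sum_nonneg fun i hi => ?_
  have hi' : i + 1 < n := by have := Finset.mem_range.mp hi; omega
  have h1 : G (i + 1) ≤ G i := by
    have : i < n := by omega
    simp only [G, this, hi', dite_true]
    exact hg (by simp [Fin.le_def])
  have h2 := hz (i + 1) hi'.le
  rw [← hZ] at h2
  rw [smul_eq_mul, ← neg_mul]
  exact mul_nonneg (by linarith) h2

theorem exists_monotone_strict_subgradient {Φ : ℝ → ℝ} (hΦ : StrictConvexOn ℝ Set.univ Φ) :
    ∃ g : ℝ → ℝ, Monotone g ∧ ∀ x y, x ≠ y → Φ x + g x * (y - x) < Φ y := by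
  -- The right derivative serves on both sides: to the left of `x`, slopes lie strictly below the
  -- left derivative, which is at most the right one.
  refine ⟨fun x => derivWithin Φ (Set.Ioi x) x, ?_, ?_⟩
  · have := hΦ.convexOn.monotoneOn_rightDeriv
    simpa [interior_univ, monotoneOn_univ] using this
  · intro x y hxy
    rcases lt_or_gt_of_ne hxy with h | h
    · have := hΦ.rightDeriv_lt_slope (Set.mem_univ x) (Set.mem_univ y) h
        (hΦ.convexOn.differentiableWithinAt_Ioi_of_mem_interior (by simp))
      rw [slope_def_field, lt_div_iff₀ (by linarith)] at this
      linarith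
    · have h1 := hΦ.slope_lt_leftDeriv (Set.mem_univ y) (Set.mem_univ x) h
        (hΦ.convexOn.differentiableWithinAt_Iio_of_mem_interior (by simp))
      have h2 := hΦ.convexOn.leftDeriv_le_rightDeriv_of_mem_interior (x := x) (by simp)
      have h3 := h1.trans_le h2
      rw [slope_def_field, div_lt_iff₀ (by linarith)] at h3
      linarith

/-- Karamata's inequality for a strictly convex function, in its strict form. -/
theorem sum_lt_sum_of_majorized {Φ : ℝ → ℝ} (hΦ : StrictConvexOn ℝ Set.univ Φ) {n : ℕ}
    {x y : Fin n → ℝ} (hx : Antitone x)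
    (hxy : ∀ (k : ℕ) (hk : k ≤ n),
      ∑ i : Fin k, x (Fin.castLE hk i) ≤ ∑ i : Fin k, y (Fin.castLE hk i))
    (heq : ∑ i, x i = ∑ i, y i) (hne : x ≠ y) : ∑ i, Φ (x i) < ∑ i, Φ (y i) := by
  obtain ⟨g, hg, hsub⟩ := exists_monotone_strict_subgradient hΦ
  -- The subgradients are taken at `x`, so only `x` has to be sorted.
  have h := sum_mul_nonneg_of_antitone (g := fun i => g (x i)) (z := fun i => y i - x i)
    (fun i j hij => hg (hx hij))
    (fun k hk => by rw [Finset.sum_sub_distrib]; linarith [hxy k hk])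
    (by rw [Finset.sum_sub_distrib, heq, sub_self])
  have hlt : ∑ i, (Φ (x i) + g (x i) * (y i - x i)) < ∑ i, Φ (y i) := by
    obtain ⟨j, hj⟩ := Function.ne_iff.mp hne
    refine Finset.sum_lt_sum (fun i _ => ?_) ⟨j, Finset.mem_univ j, hsub _ _ hj⟩
    by_cases hi : x i = y i
    · simp [hi]
    · exact (hsub _ _ hi).le
  rw [Finset.sum_add_distrib] at hlt
  linarith

/-! ### Functional calculus, eigenvalues and traces -/

/-- The spectrum is finite, so `f` agrees on it with a Lagrange interpolation polynomial; no
continuity of `f` is needed. -/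
theorem cfc_apply_of_apply_eq_smul {H : Type*} [NormedAddCommGroup H] [InnerProductSpace ℂ H]
    [CompleteSpace H] [FiniteDimensional ℂ H] (f : ℝ → ℝ) {T : H →L[ℂ] H} (hT : IsSelfAdjoint T)
    {v : H} {μ : ℝ} (hv : T v = (μ : ℂ) • v) : cfc f T v = (f μ : ℂ) • v := by
  rcases eq_or_ne v 0 with rfl | hv0
  · simp
  have hfin : (spectrum ℝ T).Finite := by
    have h1 : (spectrum ℂ T).Finite := by
      have := Module.End.finite_spectrum (T : H →ₗ[ℂ] H)
      rwa [← AlgEquiv.spectrum_eq (Module.End.toContinuousLinearMap (𝕜 := ℂ) H)] at this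
    have h2 : spectrum ℝ T = algebraMap ℝ ℂ ⁻¹' spectrum ℂ T := by
      ext x
      exact (spectrum.algebraMap_mem_iff ℂ).symm
    rw [h2]
    exact h1.preimage (FaithfulSMul.algebraMap_injective ℝ ℂ).injOn
  have hμ : μ ∈ spectrum ℝ T := by
    rw [spectrum.mem_iff]
    intro hu
    have h0 : (algebraMap ℝ (H →L[ℂ] H) μ - T) v = 0 := by
      rw [_root_.sub_apply, hv, Algebra.algebraMap_eq_smul_one]
      simp
    have hinj := (ContinuousLinearMap.isUnit_iff_bijective.mp hu).injective
    exact hv0 (hinj (by rw [h0, map_zero]))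
  let q := Lagrange.interpolate hfin.toFinset id f
  have hq : Set.EqOn f q.eval (spectrum ℝ T) := fun x hx => by
    have := Lagrange.eval_interpolate_at_node (s := hfin.toFinset) (v := id) f
      Function.injective_id.injOn (hfin.mem_toFinset.mpr hx)
    simpa [q] using this.symm
  rw [cfc_congr hq, cfc_polynomial q T hT, hq hμ]
  change Polynomial.aeval T q v = ((q.eval μ : ℝ) : ℂ) • v
  refine q.induction_on ?_ ?_ ?_
  · intro a
    rw [Polynomial.aeval_C, Polynomial.eval_C, Algebra.algebraMap_eq_smul_one]
    simp
  · intro a b ha hb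
    simp [ha, hb, add_smul]
  · intro m a h
    rw [pow_succ, ← mul_assoc, map_mul, Polynomial.aeval_X, mul_apply_eq_comp, hv,
      map_smul, h, smul_smul, Polynomial.eval_mul (p := Polynomial.C a * Polynomial.X ^ m),
      Polynomial.eval_X, Complex.ofReal_mul, mul_comm]

variable {H : Type*} [NormedAddCommGroup H] [InnerProductSpace ℂ H]
  [CompleteSpace H] [FiniteDimensional ℂ H]

/-- The eigenvalues of a self-adjoint operator, in decreasing order. -/
def eigs {T : H →L[ℂ] H} (hT : IsSelfAdjoint T) : Fin (finrank ℂ H) → ℝ :=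
  hT.isSymmetric.eigenvalues rfl

/-- An orthonormal eigenbasis of a self-adjoint operator. -/
def eigBasis {T : H →L[ℂ] H} (hT : IsSelfAdjoint T) :
    OrthonormalBasis (Fin (finrank ℂ H)) ℂ H :=
  hT.isSymmetric.eigenvectorBasis rfl

theorem apply_eigBasis {T : H →L[ℂ] H} (hT : IsSelfAdjoint T) (i : Fin (finrank ℂ H)) :
    T (eigBasis hT i) = (eigs hT i : ℂ) • eigBasis hT i :=
  hT.isSymmetric.apply_eigenvectorBasis rfl i

theorem eigs_antitone {T : H →L[ℂ] H} (hT : IsSelfAdjoint T) : Antitone (eigs hT) :=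
  hT.isSymmetric.eigenvalues_antitone rfl

theorem eigs_pos {T : H →L[ℂ] H} (hT : IsStrictlyPositive T) (i : Fin (finrank ℂ H)) :
    0 < eigs hT.isSelfAdjoint i := by
  have hne : eigs hT.isSelfAdjoint i ≠ 0 := by
    intro h0
    have h1 := apply_eigBasis hT.isSelfAdjoint i
    rw [h0, Complex.ofReal_zero, zero_smul] at h1
    have hinj := (ContinuousLinearMap.isUnit_iff_bijective.mp hT.isUnit).injective
    exact (eigBasis hT.isSelfAdjoint).toBasis.ne_zero i (by simpa using hinj (h1.trans (map_zero T).symm))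
  refine lt_of_le_of_ne ?_ hne.symm
  have hpos := (ContinuousLinearMap.nonneg_iff_isPositive T).mp hT.nonneg
  exact eigenvalue_nonneg_of_nonneg (hT.isSelfAdjoint.isSymmetric.hasEigenvalue_eigenvalues rfl i)
    fun x => hpos.re_inner_nonneg_right x

theorem traceFun_eq_sum_eigs (f : ℝ → ℝ) {T : H →L[ℂ] H} (hT : IsSelfAdjoint T) :
    traceFun f T = ∑ i, f (eigs hT i) := by
  rw [traceFun, LinearMap.trace_eq_sum_inner _ (eigBasis hT), Complex.re_sum]
  refine Finset.sum_congr rfl fun i _ => ?_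
  have h := cfc_apply_of_apply_eq_smul f hT (apply_eigBasis hT i)
  rw [ContinuousLinearMap.coe_coe, h, inner_smul_right, inner_self_eq_norm_sq_to_K]
  simp

theorem charpoly_mul_comm (S T : H →L[ℂ] H) :
    ((S * T : H →L[ℂ] H) : H →ₗ[ℂ] H).charpoly = ((T * S : H →L[ℂ] H) : H →ₗ[ℂ] H).charpoly := by
  let b := (stdOrthonormalBasis ℂ H).toBasis
  rw [← LinearMap.charpoly_toMatrix _ b, ← LinearMap.charpoly_toMatrix _ b,
    ContinuousLinearMap.toLinearMap_mul, ContinuousLinearMap.toLinearMap_mul,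
    LinearMap.toMatrix_mul, LinearMap.toMatrix_mul, Matrix.charpoly_mul_comm]

theorem traceFun_mul_comm (f : ℝ → ℝ) {S T : H →L[ℂ] H} (h : IsSelfAdjoint (S * T))
    (h' : IsSelfAdjoint (T * S)) : traceFun f (S * T) = traceFun f (T * S) := by
  rw [traceFun_eq_sum_eigs f h, traceFun_eq_sum_eigs f h', eigs, eigs,
    (LinearMap.IsSymmetric.eigenvalues_eq_eigenvalues_iff h.isSymmetric rfl h'.isSymmetric rfl).mpr
      (charpoly_mul_comm S T)]

/-! ### Gram determinants and log-majorization -/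

/-- The real part of the determinant of the matrix `⟪v i, T (v j)⟫`. -/
def gramDet {k : ℕ} (v : Fin k → H) (T : H →L[ℂ] H) : ℝ :=
  (Matrix.of fun i j => ⟪v i, T (v j)⟫_ℂ).det.re

theorem factorial_mul_gramDet {k : ℕ} (v : Fin k → H) {ι : Type*} [Fintype ι]
    (e : OrthonormalBasis ι ℂ H) (C D : H →L[ℂ] H) {d : ι → ℝ}
    (hD : ∀ l, D (e l) = (d l : ℂ) • e l) :
    (k.factorial : ℝ) * gramDet v (star C * D * C) =
      minorSum (Matrix.of fun l j => ⟪e l, C (v j)⟫_ℂ) d := by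
  classical
  have hM : (Matrix.of fun i j => ⟪v i, (star C * D * C) (v j)⟫_ℂ) =
      (Matrix.of fun l j => ⟪e l, C (v j)⟫_ℂ)ᴴ *
        (diagonal (fun l => (d l : ℂ)) * Matrix.of fun l j => ⟪e l, C (v j)⟫_ℂ) := by
    ext i j
    have h1 : D (C (v j)) = ∑ l, ⟪e l, C (v j)⟫_ℂ • (d l : ℂ) • e l := by
      conv_lhs => rw [← e.sum_repr' (C (v j)), map_sum]
      simp [hD]
    rw [Matrix.of_apply, mul_apply_eq_comp, mul_apply_eq_comp,
      ContinuousLinearMap.star_eq_adjoint, ContinuousLinearMap.adjoint_inner_right, h1, inner_sum,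
      Matrix.mul_apply]
    refine Finset.sum_congr rfl fun l _ => ?_
    simp only [inner_smul_right, Matrix.diagonal_mul, Matrix.conjTranspose_apply, Matrix.of_apply]
    rw [← starRingEnd_apply, inner_conj_symm]
    ring
  have := factorial_mul_det_conj_diagonal (Matrix.of fun l j => ⟪e l, C (v j)⟫_ℂ) d
  rw [← hM] at this
  have hre := congrArg Complex.re this
  rw [Complex.ofReal_re, ← Complex.ofReal_natCast, Complex.re_ofReal_mul] at hre
  exact hre

/-- With `gramDet_eigBasis`, this is the variational principle for the product of the `k` largest
eigenvalues. The total weight of the minors is `k!` because the frame is orthonormal. -/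
theorem gramDet_le_prod_eigs {k : ℕ} (hk : k ≤ finrank ℂ H) {v : Fin k → H}
    (hv : Orthonormal ℂ v) {T : H →L[ℂ] H} (hT : IsStrictlyPositive T) :
    gramDet v T ≤ ∏ i : Fin k, eigs hT.isSelfAdjoint (Fin.castLE hk i) := by
  have h1 := factorial_mul_gramDet v (eigBasis hT.isSelfAdjoint) 1 T (apply_eigBasis hT.isSelfAdjoint)
  have h2 := factorial_mul_gramDet v (eigBasis hT.isSelfAdjoint) 1 1 (d := fun _ => 1) (by simp)
  have h3 : gramDet v (star 1 * 1 * 1) = 1 := by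
    have : (Matrix.of fun i j => ⟪v i, (star 1 * 1 * 1 : H →L[ℂ] H) (v j)⟫_ℂ) = 1 := by
      ext i j
      simp [orthonormal_iff_ite.mp hv i j, Matrix.one_apply]
    rw [gramDet, this, Matrix.det_one, Complex.one_re]
  have h4 := minorSum_le_prod_castLE hk
    (Matrix.of fun l j => ⟪eigBasis hT.isSelfAdjoint l, (1 : H →L[ℂ] H) (v j)⟫_ℂ)
    (fun l => (eigs_pos hT l).le) (eigs_antitone hT.isSelfAdjoint)
  rw [← h1, ← h2, h3, star_one, one_mul, mul_one, mul_one, mul_comm] at h4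
  exact le_of_mul_le_mul_right h4 (Nat.cast_pos.mpr k.factorial_pos)

theorem gramDet_eigBasis {k : ℕ} (hk : k ≤ finrank ℂ H) {T : H →L[ℂ] H} (hT : IsSelfAdjoint T) :
    gramDet (fun i : Fin k => eigBasis hT (Fin.castLE hk i)) T =
      ∏ i : Fin k, eigs hT (Fin.castLE hk i) := by
  have : (Matrix.of fun i j : Fin k => ⟪eigBasis hT (Fin.castLE hk i),
      T (eigBasis hT (Fin.castLE hk j))⟫_ℂ) =
      diagonal fun i => (eigs hT (Fin.castLE hk i) : ℂ) := by
    ext i j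
    rw [Matrix.of_apply, apply_eigBasis, inner_smul_right,
      orthonormal_iff_ite.mp (eigBasis hT).orthonormal, Matrix.diagonal_apply]
    by_cases h : i = j <;> simp [h]
  rw [gramDet, this, Matrix.det_diagonal, ← Complex.ofReal_prod, Complex.ofReal_re]

theorem rpow_eigBasis {N : H →L[ℂ] H} (hN : IsStrictlyPositive N) (p : ℝ)
    (l : Fin (finrank ℂ H)) :
    (N ^ p) (eigBasis hN.isSelfAdjoint l) =
      ((eigs hN.isSelfAdjoint l ^ p : ℝ) : ℂ) • eigBasis hN.isSelfAdjoint l := by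
  rw [CFC.rpow_eq_cfc_real hN.nonneg]
  exact cfc_apply_of_apply_eq_smul _ hN.isSelfAdjoint (apply_eigBasis hN.isSelfAdjoint l)

theorem gramDet_geodesic_le {k : ℕ} (v : Fin k → H) (C : H →L[ℂ] H) {N : H →L[ℂ] H}
    (hN : IsStrictlyPositive N) {p : ℝ} (hp0 : 0 < p) (hp1 : p < 1) :
    gramDet v (star C * N ^ p * C) ≤
      gramDet v (star C * N * C) ^ p * gramDet v (star C * C) ^ (1 - p) := by
  have hfac : (0 : ℝ) < k.factorial := Nat.cast_pos.mpr k.factorial_pos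
  have hpos : ∀ l, 0 ≤ eigs hN.isSelfAdjoint l := fun l => (eigs_pos hN l).le
  have hp := factorial_mul_gramDet v _ C _ (rpow_eigBasis hN p)
  have h1 := factorial_mul_gramDet v _ C N (apply_eigBasis hN.isSelfAdjoint)
  have h0 := factorial_mul_gramDet v (eigBasis hN.isSelfAdjoint) C 1 (d := fun _ => 1) (by simp)
  rw [mul_one] at h0
  have h := minorSum_rpow_le (Matrix.of fun l j => ⟪eigBasis hN.isSelfAdjoint l, C (v j)⟫_ℂ)
    hpos hp0 hp1
  have n1 := minorSum_nonneg (Matrix.of fun l j => ⟪eigBasis hN.isSelfAdjoint l, C (v j)⟫_ℂ) hpos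
  have n0 := minorSum_nonneg (Matrix.of fun l j => ⟪eigBasis hN.isSelfAdjoint l, C (v j)⟫_ℂ)
    (d := fun _ => 1) (fun _ => zero_le_one)
  rw [← h1] at n1
  rw [← h0] at n0
  rw [← hp, ← h1, ← h0, Real.mul_rpow hfac.le (nonneg_of_mul_nonneg_right n1 hfac),
    Real.mul_rpow hfac.le (nonneg_of_mul_nonneg_right n0 hfac), mul_mul_mul_comm,
    ← Real.rpow_add hfac, add_sub_cancel, Real.rpow_one] at h
  exact le_of_mul_le_mul_left h hfac

theorem isStrictlyPositive_star_mul_mul {C D : H →L[ℂ] H} (hC : IsUnit C)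
    (hD : IsStrictlyPositive D) : IsStrictlyPositive (star C * D * C) :=
  hC.isStrictlyPositive_star_left_conjugate_iff.mpr hD

theorem isStrictlyPositive_star_mul {C : H →L[ℂ] H} (hC : IsUnit C) :
    IsStrictlyPositive (star C * C) := by
  have h1 : IsStrictlyPositive (1 : H →L[ℂ] H) :=
    IsStrictlyPositive.iff_of_unital.mpr ⟨zero_le_one, isUnit_one⟩
  have h := isStrictlyPositive_star_mul_mul hC h1
  rwa [mul_one] at h

/-- The logarithms of the `k` largest eigenvalues have a convex sum along a geodesic. -/
theorem sum_log_eigs_geodesic_le {C N : H →L[ℂ] H} {p : ℝ} (hp0 : 0 < p) (hp1 : p < 1)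
    (hN : IsStrictlyPositive N) (hWp : IsStrictlyPositive (star C * N ^ p * C))
    (hW1 : IsStrictlyPositive (star C * N * C)) (hW0 : IsStrictlyPositive (star C * C))
    {k : ℕ} (hk : k ≤ finrank ℂ H) :
    ∑ i : Fin k, Real.log (eigs hWp.isSelfAdjoint (Fin.castLE hk i)) ≤
      ∑ i : Fin k, (p * Real.log (eigs hW1.isSelfAdjoint (Fin.castLE hk i)) +
        (1 - p) * Real.log (eigs hW0.isSelfAdjoint (Fin.castLE hk i))) := by
  -- This frame attains the maximum for `star C * N ^ p * C`; for the other two operators it only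
  -- gives a lower bound on the maximum.
  let v : Fin k → H := fun i => eigBasis hWp.isSelfAdjoint (Fin.castLE hk i)
  have hv : Orthonormal ℂ v :=
    (eigBasis hWp.isSelfAdjoint).orthonormal.comp _ (Fin.castLE_injective hk)
  have gram_nonneg : ∀ D : H →L[ℂ] H, IsStrictlyPositive D → 0 ≤ gramDet v D := by
    intro D hD
    have h := factorial_mul_gramDet v _ 1 D (apply_eigBasis hD.isSelfAdjoint)
    have h' := minorSum_nonneg
      (Matrix.of fun l j => ⟪eigBasis hD.isSelfAdjoint l, (1 : H →L[ℂ] H) (v j)⟫_ℂ)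
      (fun l => (eigs_pos hD l).le)
    rw [← h, star_one, one_mul, mul_one] at h'
    exact nonneg_of_mul_nonneg_right h' (Nat.cast_pos.mpr k.factorial_pos)
  have pos : ∀ {D : H →L[ℂ] H} (hD : IsStrictlyPositive D),
      0 < ∏ i : Fin k, eigs hD.isSelfAdjoint (Fin.castLE hk i) :=
    fun hD => Finset.prod_pos fun i _ => eigs_pos hD _
  have hlog : ∀ {D : H →L[ℂ] H} (hD : IsStrictlyPositive D),
      Real.log (∏ i : Fin k, eigs hD.isSelfAdjoint (Fin.castLE hk i)) =
        ∑ i : Fin k, Real.log (eigs hD.isSelfAdjoint (Fin.castLE hk i)) :=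
    fun hD => Real.log_prod fun i _ => (eigs_pos hD _).ne'
  have key : ∏ i : Fin k, eigs hWp.isSelfAdjoint (Fin.castLE hk i) ≤
      (∏ i : Fin k, eigs hW1.isSelfAdjoint (Fin.castLE hk i)) ^ p *
        (∏ i : Fin k, eigs hW0.isSelfAdjoint (Fin.castLE hk i)) ^ (1 - p) := by
    rw [← gramDet_eigBasis hk hWp.isSelfAdjoint]
    refine (gramDet_geodesic_le v C hN hp0 hp1).trans ?_
    exact mul_le_mul
      (Real.rpow_le_rpow (gram_nonneg _ hW1) (gramDet_le_prod_eigs hk hv hW1) hp0.le)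
      (Real.rpow_le_rpow (gram_nonneg _ hW0) (gramDet_le_prod_eigs hk hv hW0) (by linarith))
      (Real.rpow_nonneg (gram_nonneg _ hW0) _) (Real.rpow_nonneg (pos hW1).le _)
  have h := Real.log_le_log (pos hWp) key
  rw [Real.log_mul (Real.rpow_pos_of_pos (pos hW1) _).ne' (Real.rpow_pos_of_pos (pos hW0) _).ne',
    Real.log_rpow (pos hW1), Real.log_rpow (pos hW0), hlog hWp, hlog hW1, hlog hW0] at h
  rwa [Finset.sum_add_distrib, ← Finset.mul_sum, ← Finset.mul_sum]

/-! ### Determinant and trace identities; the equality case -/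

theorem det_eq_prod_of_apply_eq_smul {ι : Type*} [Fintype ι] (e : OrthonormalBasis ι ℂ H)
    {D : H →L[ℂ] H} {d : ι → ℝ} (hD : ∀ l, D (e l) = (d l : ℂ) • e l) :
    LinearMap.det (D : H →ₗ[ℂ] H) = ((∏ l, d l : ℝ) : ℂ) := by
  classical
  rw [← LinearMap.det_toMatrix e.toBasis]
  have : LinearMap.toMatrix e.toBasis e.toBasis (D : H →ₗ[ℂ] H) =
      diagonal fun l => (d l : ℂ) := by
    ext i j
    rw [LinearMap.toMatrix_apply, e.coe_toBasis, e.coe_toBasis_repr_apply, e.repr_apply_apply,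
      ContinuousLinearMap.coe_coe, hD, inner_smul_right, orthonormal_iff_ite.mp e.orthonormal,
      Matrix.diagonal_apply]
    by_cases h : i = j <;> simp [h]
  rw [this, Matrix.det_diagonal, Complex.ofReal_prod]

theorem prod_eigs_star_mul_mul {C D : H →L[ℂ] H} {ι : Type*} [Fintype ι]
    (e : OrthonormalBasis ι ℂ H) {d : ι → ℝ} (hD : ∀ l, D (e l) = (d l : ℂ) • e l)
    (hW : IsSelfAdjoint (star C * D * C)) (hW0 : IsSelfAdjoint (star C * C)) :
    ∏ i, eigs hW i = (∏ l, d l) * ∏ i, eigs hW0 i := by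
  have h := det_eq_prod_of_apply_eq_smul _ (apply_eigBasis hW)
  have h0 := det_eq_prod_of_apply_eq_smul _ (apply_eigBasis hW0)
  have hd := det_eq_prod_of_apply_eq_smul e hD
  simp only [ContinuousLinearMap.toLinearMap_mul, map_mul] at h h0
  rw [← Complex.ofReal_inj, Complex.ofReal_mul, ← h, ← h0, ← hd]
  ring

theorem sum_log_eigs_geodesic_eq {C N : H →L[ℂ] H} {p : ℝ}
    (hN : IsStrictlyPositive N) (hWp : IsStrictlyPositive (star C * N ^ p * C))
    (hW1 : IsStrictlyPositive (star C * N * C)) (hW0 : IsStrictlyPositive (star C * C)) :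
    ∑ i, Real.log (eigs hWp.isSelfAdjoint i) =
      ∑ i, (p * Real.log (eigs hW1.isSelfAdjoint i) +
        (1 - p) * Real.log (eigs hW0.isSelfAdjoint i)) := by
  have hp := prod_eigs_star_mul_mul _ (rpow_eigBasis hN p) hWp.isSelfAdjoint hW0.isSelfAdjoint
  have h1 := prod_eigs_star_mul_mul _ (apply_eigBasis hN.isSelfAdjoint) hW1.isSelfAdjoint
    hW0.isSelfAdjoint
  have hpos : 0 < ∏ l, eigs hN.isSelfAdjoint l := Finset.prod_pos fun l _ => eigs_pos hN l
  have hpos0 : 0 < ∏ l, eigs hW0.isSelfAdjoint l := Finset.prod_pos fun l _ => eigs_pos hW0 l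
  rw [Real.finsetProd_rpow _ _ fun l _ => (eigs_pos hN l).le] at hp
  have lp := congrArg Real.log hp
  have l1 := congrArg Real.log h1
  rw [Real.log_mul (Real.rpow_pos_of_pos hpos _).ne' hpos0.ne', Real.log_rpow hpos] at lp
  rw [Real.log_mul hpos.ne' hpos0.ne'] at l1
  rw [Finset.sum_add_distrib, ← Finset.mul_sum, ← Finset.mul_sum,
    ← Real.log_prod fun i _ => (eigs_pos hWp i).ne', ← Real.log_prod fun i _ => (eigs_pos hW1 i).ne',
    ← Real.log_prod fun i _ => (eigs_pos hW0 i).ne', lp, l1]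
  ring

theorem sum_eigs_star_mul_mul {C D : H →L[ℂ] H} {ι : Type*} [Fintype ι]
    (e : OrthonormalBasis ι ℂ H) {d : ι → ℝ} (hD : ∀ l, D (e l) = (d l : ℂ) • e l)
    (hW : IsSelfAdjoint (star C * D * C)) :
    ∑ i, eigs hW i = ∑ l, d l * ‖star C (e l)‖ ^ 2 := by
  have h := hW.isSymmetric.re_trace_eq_sum_eigenvalues rfl
  rw [eigs, ← h, ContinuousLinearMap.toLinearMap_mul, ContinuousLinearMap.toLinearMap_mul,
    mul_assoc, LinearMap.trace_mul_comm, mul_assoc, LinearMap.trace_mul_comm,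
    LinearMap.trace_eq_sum_inner _ e, map_sum]
  refine Finset.sum_congr rfl fun l _ => ?_
  have : ⟪e l, C (star C (D (e l)))⟫_ℂ = ((d l * ‖star C (e l)‖ ^ 2 : ℝ) : ℂ) := by
    rw [hD, map_smul, map_smul, inner_smul_right]
    rw [← ContinuousLinearMap.adjoint_inner_left, ← ContinuousLinearMap.star_eq_adjoint,
      inner_self_eq_norm_sq_to_K]
    simp
  exact (congrArg Complex.re this).trans (Complex.ofReal_re _)

/-- In the eigenbasis of `N` the three traces are sums of `t^p`, `t` and `1` with common weights
`‖star C e‖²`, positive as `C` is invertible. Bernoulli's `t^p < pt + 1 - p` for `t ≠ 1` then leaves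
only `t = 1`. -/
theorem eq_one_of_eigs_geodesic_eq {C N : H →L[ℂ] H} {p : ℝ} (hp0 : 0 < p) (hp1 : p < 1)
    (hC : IsUnit C) (hN : IsStrictlyPositive N) (hWp : IsSelfAdjoint (star C * N ^ p * C))
    (hW1 : IsSelfAdjoint (star C * N * C)) (hW0 : IsSelfAdjoint (star C * C))
    (h : ∑ i, eigs hWp i = p * ∑ i, eigs hW1 i + (1 - p) * ∑ i, eigs hW0 i) : N = 1 := by
  have hW0' : IsSelfAdjoint (star C * 1 * C) := by simp
  have e0 : ∑ i, eigs hW0 i = ∑ i, eigs hW0' i := by simp only [mul_one]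
  rw [e0, sum_eigs_star_mul_mul _ (rpow_eigBasis hN p),
    sum_eigs_star_mul_mul _ (apply_eigBasis hN.isSelfAdjoint),
    sum_eigs_star_mul_mul (eigBasis hN.isSelfAdjoint) (d := fun _ => 1) (by simp), Finset.mul_sum,
    Finset.mul_sum, ← Finset.sum_add_distrib] at h
  have hlt : ∀ l, eigs hN.isSelfAdjoint l ≠ 1 →
      eigs hN.isSelfAdjoint l ^ p < p * eigs hN.isSelfAdjoint l + (1 - p) := fun l hl => by
    have := rpow_one_add_lt_one_add_mul_self (s := eigs hN.isSelfAdjoint l - 1)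
      (by linarith [eigs_pos hN l]) (sub_ne_zero.mpr hl) hp0 hp1
    rw [add_sub_cancel] at this
    linarith
  have hone : ∀ l, eigs hN.isSelfAdjoint l = 1 := by
    by_contra hcon
    push Not at hcon
    obtain ⟨l, hl⟩ := hcon
    refine h.not_lt (Finset.sum_lt_sum (fun i _ => ?_) ⟨l, Finset.mem_univ l, ?_⟩)
    · have hi : eigs hN.isSelfAdjoint i ^ p ≤ p * eigs hN.isSelfAdjoint i + (1 - p) := by
        by_cases hi : eigs hN.isSelfAdjoint i = 1
        · simp [hi]
        · exact (hlt i hi).le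
      nlinarith [mul_le_mul_of_nonneg_right hi (sq_nonneg ‖star C (eigBasis hN.isSelfAdjoint i)‖)]
    · have hinj := (ContinuousLinearMap.isUnit_iff_bijective.mp hC.star).injective
      have hne : star C (eigBasis hN.isSelfAdjoint l) ≠ 0 := fun h0 =>
        (eigBasis hN.isSelfAdjoint).toBasis.ne_zero l
          (by simpa using hinj (h0.trans (map_zero (star C)).symm))
      have hn : 0 < ‖star C (eigBasis hN.isSelfAdjoint l)‖ ^ 2 := by positivity
      nlinarith [mul_lt_mul_of_pos_right (hlt l hl) hn]
  apply ContinuousLinearMap.coe_injective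
  refine (eigBasis hN.isSelfAdjoint).toBasis.ext fun l => ?_
  simp [apply_eigBasis, hone]

/-- Strict convexity of the trace function between `star C * C` and `star C * N * C`. -/
theorem traceFun_geodesic_lt {f : ℝ → ℝ} (hf : IsStrictlyConvexLog f) {C N : H →L[ℂ] H} {p : ℝ}
    (hp0 : 0 < p) (hp1 : p < 1) (hC : IsUnit C) (hN : IsStrictlyPositive N) (hne : N ≠ 1) :
    traceFun f (star C * N ^ p * C) <
      p * traceFun f (star C * N * C) + (1 - p) * traceFun f (star C * C) := by
  obtain ⟨Φ, hΦ, hfΦ⟩ := hf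
  have hWp := isStrictlyPositive_star_mul_mul hC (IsStrictlyPositive.rpow N p hN)
  have hW1 := isStrictlyPositive_star_mul_mul hC hN
  have hW0 := isStrictlyPositive_star_mul hC
  have htr : ∀ {D : H →L[ℂ] H} (hD : IsStrictlyPositive D),
      traceFun f D = ∑ i, Φ (Real.log (eigs hD.isSelfAdjoint i)) := fun hD => by
    rw [traceFun_eq_sum_eigs f hD.isSelfAdjoint]
    exact Finset.sum_congr rfl fun i _ => hfΦ _ (eigs_pos hD i)
  rw [htr hWp, htr hW1, htr hW0, Finset.mul_sum, Finset.mul_sum, ← Finset.sum_add_distrib]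
  let x := fun i => Real.log (eigs hWp.isSelfAdjoint i)
  let y1 := fun i => Real.log (eigs hW1.isSelfAdjoint i)
  let y0 := fun i => Real.log (eigs hW0.isSelfAdjoint i)
  let y := fun i => p * y1 i + (1 - p) * y0 i
  have hle : ∀ i, Φ (y i) ≤ p * Φ (y1 i) + (1 - p) * Φ (y0 i) := fun i =>
    hΦ.convexOn.2 (Set.mem_univ _) (Set.mem_univ _) hp0.le (by linarith) (by ring)
  -- If `x = y`, Karamata is not strict, so strictness must come from Jensen at some index; if `x ≠
  -- y`, Karamata is already strict.
  by_cases hxy : x = y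
  · have hy : ∃ i, y1 i ≠ y0 i := by
      by_contra! hall
      have h1 : ∀ i, eigs hW1.isSelfAdjoint i = eigs hW0.isSelfAdjoint i := fun i =>
        Real.log_injOn_pos (eigs_pos hW1 i) (eigs_pos hW0 i) (hall i)
      have hp : ∀ i, eigs hWp.isSelfAdjoint i = eigs hW0.isSelfAdjoint i := fun i => by
        refine Real.log_injOn_pos (eigs_pos hWp i) (eigs_pos hW0 i) ?_
        have := congrFun hxy i
        simp only [y, hall i] at this
        exact this.trans (by ring)
      refine hne (eq_one_of_eigs_geodesic_eq hp0 hp1 hC hN hWp.isSelfAdjoint hW1.isSelfAdjoint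
        hW0.isSelfAdjoint ?_)
      simp only [h1, hp]
      ring
    obtain ⟨j, hj⟩ := hy
    calc ∑ i, Φ (x i) = ∑ i, Φ (y i) := by rw [hxy]
      _ < _ := Finset.sum_lt_sum (fun i _ => hle i) ⟨j, Finset.mem_univ j,
        hΦ.2 (Set.mem_univ _) (Set.mem_univ _) hj hp0 (by linarith) (by ring)⟩
  · refine (sum_lt_sum_of_majorized hΦ (x := x) (y := y) ?_ ?_ ?_ hxy).trans_le
      (Finset.sum_le_sum fun i _ => hle i)
    · exact fun i j hij => Real.log_le_log (eigs_pos hWp j) (eigs_antitone hWp.isSelfAdjoint hij)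
    · exact fun k hk => sum_log_eigs_geodesic_le hp0 hp1 hN hWp hW1 hW0 hk
    · exact sum_log_eigs_geodesic_eq hN hWp hW1 hW0

/-! ### Reduction of the trace function to conjugations by a fixed operator -/

/-- With `P = X^{-1/2} A^{1/2}` the two arguments are `PP*` and `P*P`. The second form depends on
`X` only through its inverse, conjugated by the fixed `A^{1/2}`. -/
theorem traceFunAt_eq (f : ℝ → ℝ) {A X : H →L[ℂ] H} (hA : IsStrictlyPositive A)
    (hX : IsStrictlyPositive X) :
    traceFunAt f A X = traceFun f (A ^ (1 / 2 : ℝ) * X ^ (-1 : ℝ) * A ^ (1 / 2 : ℝ)) := by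
  have hsA : A ^ (1 / 2 : ℝ) * A ^ (1 / 2 : ℝ) = A := by
    rw [← CFC.rpow_add hA.isUnit]; norm_num; exact CFC.rpow_one A hA.nonneg
  have hsX : X ^ (-(1 / 2) : ℝ) * X ^ (-(1 / 2) : ℝ) = X ^ (-1 : ℝ) := by
    rw [← CFC.rpow_add hX.isUnit]; norm_num
  have saA : IsSelfAdjoint (A ^ (1 / 2 : ℝ)) := (IsStrictlyPositive.rpow A _ hA).isSelfAdjoint
  have saX : IsSelfAdjoint (X ^ (-(1 / 2) : ℝ)) := (IsStrictlyPositive.rpow X _ hX).isSelfAdjoint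
  have e1 : X ^ (-(1 / 2) : ℝ) * A * X ^ (-(1 / 2) : ℝ) =
      (X ^ (-(1 / 2) : ℝ) * A ^ (1 / 2 : ℝ)) * (A ^ (1 / 2 : ℝ) * X ^ (-(1 / 2) : ℝ)) := by
    conv_lhs => rw [← hsA]
    simp only [mul_assoc]
  have e2 : A ^ (1 / 2 : ℝ) * X ^ (-1 : ℝ) * A ^ (1 / 2 : ℝ) =
      (A ^ (1 / 2 : ℝ) * X ^ (-(1 / 2) : ℝ)) * (X ^ (-(1 / 2) : ℝ) * A ^ (1 / 2 : ℝ)) := by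
    rw [← hsX]
    simp only [mul_assoc]
  rw [traceFunAt, e1, e2]
  have hst : star (X ^ (-(1 / 2) : ℝ) * A ^ (1 / 2 : ℝ)) =
      A ^ (1 / 2 : ℝ) * X ^ (-(1 / 2) : ℝ) := by
    rw [star_mul, saA.star_eq, saX.star_eq]
  rw [← hst]
  exact traceFun_mul_comm f (IsSelfAdjoint.mul_star_self _) (IsSelfAdjoint.star_mul_self _)

theorem rpow_neg_one_eq_of_mul_eq_one {X V : H →L[ℂ] H} (hX : IsStrictlyPositive X)
    (h : X * V = 1) : X ^ (-1 : ℝ) = V := by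
  refine left_inv_eq_right_inv ?_ h
  have := CFC.rpow_neg_mul_rpow 1 hX
  rwa [CFC.rpow_one X hX.nonneg] at this

end GeodConvex
end

theorem corollary3p5 {H : Type*} [NormedAddCommGroup H] [InnerProductSpace ℂ H]
    [CompleteSpace H] [FiniteDimensional ℂ H]
    (A : H →L[ℂ] H) (hA : IsStrictlyPositive A)
    (f : ℝ → ℝ) (hf : AnalyticOnNhd ℝ f (Set.Ioi 0))
    (hlog : GeodConvex.IsStrictlyConvexLog f) :
    GeodConvex.IsStrictlyGeodConvex (fun X : H →L[ℂ] H => GeodConvex.traceFunAt f A X) := by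
  intro X Y hX hY hXY p hp0 hp1
  let R := Y ^ (1 / 2 : ℝ)
  let S := Y ^ (-(1 / 2) : ℝ)
  have hR : IsStrictlyPositive R := IsStrictlyPositive.rpow Y _ hY
  have hS : IsStrictlyPositive S := IsStrictlyPositive.rpow Y _ hY
  have hRS : R * S = 1 := CFC.rpow_mul_rpow_neg _ hY
  have hSR : S * R = 1 := CFC.rpow_neg_mul_rpow _ hY
  have hSS : S * S = Y ^ (-1 : ℝ) := by
    simp only [S]
    rw [← CFC.rpow_add hY.isUnit]; norm_num
  have hRR : R * R = Y := by
    simp only [R]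
    rw [← CFC.rpow_add hY.isUnit]; norm_num; exact CFC.rpow_one Y hY.nonneg
  let M := S * X * S
  have hM : IsStrictlyPositive M := by
    have := hS.isUnit.isStrictlyPositive_star_left_conjugate_iff.mpr hX
    rwa [hS.isSelfAdjoint.star_eq] at this
  have hRMR : R * M * R = X := by
    calc R * M * R = (R * S) * X * (S * R) := by simp only [M, mul_assoc]
      _ = X := by rw [hRS, hSR, one_mul, mul_one]
  -- Inverting `R * M ^ p * R` gives `S * N ^ p * S`, so the inverses of the geodesic again run
  -- along powers of one operator.
  let N := M ^ (-1 : ℝ)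
  have hN : IsStrictlyPositive N := IsStrictlyPositive.rpow M _ hM
  have hMN : M * N = 1 := by
    have := CFC.rpow_mul_rpow_neg 1 hM
    rwa [CFC.rpow_one M hM.nonneg] at this
  have hG : IsStrictlyPositive (R * M ^ p * R) := by
    have := hR.isUnit.isStrictlyPositive_star_left_conjugate_iff.mpr (IsStrictlyPositive.rpow M p hM)
    rwa [hR.isSelfAdjoint.star_eq] at this
  have hMpNp : M ^ p * N ^ p = 1 := by
    have : N ^ p = M ^ (-p) := by
      simp only [N]
      rw [CFC.rpow_rpow M _ _ (by norm_num) hM, neg_one_mul]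
    rw [this]
    exact CFC.rpow_mul_rpow_neg _ hM
  have conj_inv : ∀ P Q : H →L[ℂ] H, P * Q = 1 → (R * P * R) * (S * Q * S) = 1 := by
    intro P Q hPQ
    calc (R * P * R) * (S * Q * S) = R * P * (R * S) * Q * S := by simp only [mul_assoc]
      _ = R * (P * Q) * S := by rw [hRS]; simp only [mul_assoc, one_mul]
      _ = 1 := by rw [hPQ, mul_one, hRS]
  have hGi : (R * M ^ p * R) ^ (-1 : ℝ) = S * N ^ p * S :=
    GeodConvex.rpow_neg_one_eq_of_mul_eq_one hG (conj_inv _ _ hMpNp)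
  have hXi : X ^ (-1 : ℝ) = S * N * S :=
    GeodConvex.rpow_neg_one_eq_of_mul_eq_one hX (by rw [← conj_inv _ _ hMN, hRMR])
  have hN1 : N ≠ 1 := by
    intro h
    rw [h, mul_one] at hMN
    apply hXY
    rw [← hRMR, hMN, mul_one, hRR]
  have hB : IsStrictlyPositive (A ^ (1 / 2 : ℝ)) := IsStrictlyPositive.rpow A _ hA
  have hstar : star (S * A ^ (1 / 2 : ℝ)) = A ^ (1 / 2 : ℝ) * S := by
    rw [star_mul, hB.isSelfAdjoint.star_eq, hS.isSelfAdjoint.star_eq]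
  have h := GeodConvex.traceFun_geodesic_lt hlog hp0 hp1 (hS.isUnit.mul hB.isUnit) hN hN1
  change GeodConvex.traceFunAt f A (R * M ^ p * R) < _
  dsimp only
  rw [GeodConvex.traceFunAt_eq f hA hG, GeodConvex.traceFunAt_eq f hA hX,
    GeodConvex.traceFunAt_eq f hA hY, hGi, hXi, ← hSS]
  rw [hstar] at h
  simpa only [mul_assoc] using h
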